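/- Let $\alpha,\beta>-1$, $M\ge 0$, $N>0$. Let $p_n=p_n^{(\alpha,\beta)}$ be the polynomials (of degree $n$, with positive leading coefficient) orthonormal with respect to $\int_{-1}^{1} f(x)g(x)(1-x)^\alpha(1+x)^\beta\,dx$, and let $q_n=q_n^{(\alpha,\beta)}$ be the polynomials (of degree $n$, with positive leading coefficient) orthonormal with respect to $$\langle f,g\rangle=\int_{-1}^{1} f(x)g(x)(1-x)^\alpha(1+x)^\beta\,dx+Mf(1)g(1)+Nf'(1)g'(1).$$ Write $z_n\cong w_n$ when $z_n/w_n\to 1$ as $n\to\infty$. Below, $C$ denotes a positive constant, possibly different at each occurrence, which does not depend on $n$ (only on $\alpha,\beta,M,N$). Then $$q_n(-1)\cong p_n(-1)\cong C(-1)^n n^{\beta+1/2},$$ $$q_n'(-1)\cong p_n'(-1)\cong C(-1)^{n+1} n^{\beta+5/2},$$ $$q_n(1)\cong\begin{cases}-C\,n^{-\alpha-3/2} & \text{if } MN>0,\\ -C\,n^{\alpha+1/2} & \text{if } M=0,\end{cases}$$ $$q_n'(1)\cong C\,n^{-\alpha-7/2}.$$ -/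

import Mathlib

open Polynomial Filter Topology

/-- The Jacobi inner product `∫_{[-1,1]} f g (1-x)^α (1+x)^β dx` on real polynomials. -/
noncomputable def jacobiInner (α β : ℝ) (f g : ℝ[X]) : ℝ :=
  ∫ x in (-1 : ℝ)..1, f.eval x * g.eval x * ((1 - x) ^ α * (1 + x) ^ β)

/-- The Jacobi-Sobolev type inner product
`∫_{[-1,1]} f g (1-x)^α (1+x)^β dx + M f(1) g(1) + N f'(1) g'(1)` on real polynomials. -/
noncomputable def jacobiSobolevInner (α β M N : ℝ) (f g : ℝ[X]) : ℝ :=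
  jacobiInner α β f g + M * (f.eval 1 * g.eval 1)
    + N * ((derivative f).eval 1 * (derivative g).eval 1)

/-- `p` is the sequence of orthonormal polynomials of the bilinear form `B`: `p n` has degree `n`
and positive leading coefficient, and the `p n` are orthonormal with respect to `B`. -/
structure IsOrthonormalPolySeq (B : ℝ[X] → ℝ[X] → ℝ) (p : ℕ → ℝ[X]) : Prop where
  natDegree_eq : ∀ n, (p n).natDegree = n
  leadingCoeff_pos : ∀ n, 0 < (p n).leadingCoeff
  orthogonal : ∀ m n, m ≠ n → B (p m) (p n) = 0
  normalized : ∀ n, B (p n) (p n) = 1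

/-- `z ≅ w`: the sequence `z n / w n` converges to `1`. -/
def AsympEq (z w : ℕ → ℝ) : Prop :=
  Tendsto (fun n => z n / w n) atTop (𝓝 1)

/-! Expand `q n` in the Jacobi basis. Orthogonality to `p k` for k < n fixes the coefficients
(`sobolev_expansion`): q_n = γ_n p_n - M q_n(1) Σ_{k<n} p_k(1) p_k - N q_n'(1) Σ_{k<n} p_k'(1) p_k.
Taking values and derivatives at 1 gives a 2×2 linear system for q_n(1), q_n'(1), solved by Cramer's
rule (`sobolev_solution`). Since p_k(1) ~ A k^(α+1/2) and p_k'(1) ~ B k^(α+5/2), every sum in it has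
power growth. The leading terms of determinant and numerators do not cancel, and they give the
orders and signs (`exists_sobolev_powAsymp`). The normalization of q_n becomes γ_n² (1 + O(1/n)) =
1, so γ_n → 1.

At -1 the numbers p_k(-1) and p_k'(-1) alternate in sign. Bounded termwise, the corrections would
have the order of the main term; the alternation makes them smaller (`alternating_sum`).

The Jacobi asymptotics come from an explicit polynomial whose orthogonality is a statement about
n-th finite differences and whose norm is a quotient of gamma values. The reflection x ↦ -x, which
swaps α and β, transfers them to -1. -/

/-- `f n` behaves like `c * n ^ s`, in the sense that `f n / n ^ s → c`; here `c = 0` is allowed. -/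
def PowAsymp (f : ℕ → ℝ) (s c : ℝ) : Prop :=
  Tendsto (fun n => f n / (n : ℝ) ^ s) atTop (𝓝 c)

/-! ### Calculus of power asymptotics: sums, alternating sums, gamma quotients. -/

namespace PowAsymp

variable {f g : ℕ → ℝ} {s t c d : ℝ}

theorem congr' (hf : PowAsymp f s c) (h : f =ᶠ[atTop] g) : PowAsymp g s c :=
  Tendsto.congr' (h.mono fun n hn => by simp only [hn]) hf

theorem cast (hf : PowAsymp f s c) (hs : s = t) (hc : c = d) : PowAsymp f t d := hs ▸ hc ▸ hf

theorem add (hf : PowAsymp f s c) (hg : PowAsymp g s d) :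
    PowAsymp (fun n => f n + g n) s (c + d) :=
  (Tendsto.add hf hg).congr fun n => by rw [add_div]

theorem sub (hf : PowAsymp f s c) (hg : PowAsymp g s d) :
    PowAsymp (fun n => f n - g n) s (c - d) :=
  (Tendsto.sub hf hg).congr fun n => by rw [sub_div]

theorem const_mul (a : ℝ) (hf : PowAsymp f s c) : PowAsymp (fun n => a * f n) s (a * c) :=
  (Tendsto.const_mul a hf).congr fun n => by rw [mul_div_assoc]

theorem mul (hf : PowAsymp f s c) (hg : PowAsymp g t d) :
    PowAsymp (fun n => f n * g n) (s + t) (c * d) := by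
  refine (Tendsto.mul hf hg).congr' ?_
  filter_upwards [eventually_gt_atTop 0] with n hn
  rw [Real.rpow_add (by positivity), div_mul_div_comm]

theorem div (hf : PowAsymp f s c) (hg : PowAsymp g t d) (hd : d ≠ 0) :
    PowAsymp (fun n => f n / g n) (s - t) (c / d) := by
  refine (Tendsto.div hf hg hd).congr' ?_
  filter_upwards [eventually_gt_atTop 0] with n hn
  rw [Pi.div_apply, Real.rpow_sub (by positivity), div_div_div_comm]

theorem tendsto (hf : PowAsymp f 0 c) : Tendsto f atTop (𝓝 c) :=
  Tendsto.congr (fun n => by simp) hf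

theorem of_tendsto (hf : Tendsto f atTop (𝓝 c)) : PowAsymp f 0 c :=
  hf.congr fun n => by simp

theorem const (a : ℝ) : PowAsymp (fun _ => a) 0 a := of_tendsto tendsto_const_nhds

theorem rpow (s : ℝ) : PowAsymp (fun n => (n : ℝ) ^ s) s 1 := by
  refine tendsto_const_nhds.congr' ?_
  filter_upwards [eventually_gt_atTop 0] with n hn
  rw [div_self (by positivity)]

theorem of_lt (hf : PowAsymp f s c) (h : s < t) : PowAsymp f t 0 := by
  have h1 : Tendsto (fun n : ℕ => (n : ℝ) ^ (-(t - s))) atTop (𝓝 0) :=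
    (tendsto_rpow_neg_atTop (sub_pos.2 h)).comp tendsto_natCast_atTop_atTop
  have := Tendsto.mul hf h1
  rw [mul_zero] at this
  refine this.congr' ?_
  filter_upwards [eventually_gt_atTop 0] with n hn
  rw [neg_sub, Real.rpow_sub (by positivity)]
  have : (n : ℝ) ^ s ≠ 0 := by positivity
  field_simp

theorem add_of_lt (hf : PowAsymp f s c) (hg : PowAsymp g t d) (h : t < s) :
    PowAsymp (fun n => f n + g n) s c := by
  simpa using hf.add (hg.of_lt h)

theorem natCast_add (a : ℝ) : PowAsymp (fun n => (n : ℝ) + a) 1 1 :=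
  (by simpa using rpow 1 : PowAsymp (fun n => (n : ℝ)) 1 1).add_of_lt (const a) one_pos

theorem abs (hf : PowAsymp f s c) : PowAsymp (fun n => |f n|) s |c| :=
  (Tendsto.abs hf).congr fun n => by
    rw [abs_div, abs_of_nonneg (Real.rpow_nonneg n.cast_nonneg s)]

theorem of_abs (hf : PowAsymp (fun n => |f n|) s 0) : PowAsymp f s 0 := by
  refine (tendsto_zero_iff_abs_tendsto_zero _).2 (Tendsto.congr (fun n => ?_) hf)
  rw [Function.comp_apply, abs_div, abs_of_nonneg (Real.rpow_nonneg n.cast_nonneg s)]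

theorem neg_one_pow_mul (hf : PowAsymp f s 0) : PowAsymp (fun n => (-1) ^ n * f n) s 0 :=
  of_abs ((hf.abs.cast rfl abs_zero).congr' (.of_forall fun n => by simp [abs_mul]))

theorem of_sq (hf : PowAsymp (fun n => f n ^ 2) (2 * s) c) (h0 : ∀ᶠ n in atTop, 0 ≤ f n) :
    PowAsymp f s (√c) := by
  refine (Tendsto.sqrt hf).congr' ?_
  filter_upwards [h0, eventually_gt_atTop 0] with n hn hn0
  rw [Real.sqrt_div (sq_nonneg _), Real.sqrt_sq hn, mul_comm, Real.rpow_mul n.cast_nonneg,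
    Real.rpow_two, Real.sqrt_sq (by positivity)]

theorem eventually_pos (hf : PowAsymp f s c) (hc : 0 < c) : ∀ᶠ n in atTop, 0 < f n := by
  filter_upwards [Tendsto.eventually_const_lt hc hf, eventually_gt_atTop 0] with n hn hn0
  exact (div_pos_iff_of_pos_right (by positivity)).1 hn

theorem shift (hf : PowAsymp f s c) : PowAsymp (fun n => f (n + 1)) s c := by
  have h1 : Tendsto (fun n : ℕ => (((n : ℝ) + 1) / n) ^ s) atTop (𝓝 (1 ^ s)) := by
    refine Tendsto.rpow_const ?_ (Or.inl one_ne_zero)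
    exact Tendsto.congr (fun n => by simp) (natCast_add 1)
  have := (Tendsto.comp hf (tendsto_add_atTop_nat 1)).mul h1
  rw [Real.one_rpow, mul_one] at this
  refine this.congr' ?_
  filter_upwards [eventually_gt_atTop 0] with n hn
  rw [Real.div_rpow (by positivity) (by positivity)]
  have h2 : ((n : ℝ) + 1) ^ s ≠ 0 := by positivity
  simp only [Function.comp_apply, Nat.cast_add, Nat.cast_one]
  field_simp

/-- With h = 1/n this is n^(t-1) times the difference quotient of x^t at 1. -/
theorem rpow_succ_sub (t : ℝ) :
    PowAsymp (fun n => ((n : ℝ) + 1) ^ t - (n : ℝ) ^ t) (t - 1) t := by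
  have h := (Real.hasDerivAt_rpow_const (x := 1) (p := t) (Or.inl one_ne_zero)).tendsto_slope_zero
  simp only [Real.one_rpow, mul_one] at h
  have h1 : Tendsto (fun n : ℕ => ((n : ℝ))⁻¹) atTop (𝓝[≠] 0) := by
    refine tendsto_nhdsWithin_iff.2 ⟨tendsto_inv_atTop_nhds_zero_nat, ?_⟩
    filter_upwards [eventually_gt_atTop 0] with n hn
    simp [hn.ne']
  refine (h.comp h1).congr' ?_
  filter_upwards [eventually_gt_atTop 0] with n hn
  have hn' : (0 : ℝ) < n := by positivity
  have h2 : 1 + ((n : ℝ))⁻¹ = (n + 1) / n := by field_simp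
  simp only [Function.comp_apply, inv_inv, h2, smul_eq_mul]
  rw [Real.div_rpow (by positivity) (by positivity), Real.rpow_sub_one hn'.ne']
  have : (n : ℝ) ^ t ≠ 0 := by positivity
  field_simp

/-- Sums of a sequence of power growth. -/
theorem sum (hf : PowAsymp f s c) (hs : -1 < s) :
    PowAsymp (fun n => ∑ k ∈ Finset.range n, f k) (s + 1) (c / (s + 1)) := by
  have hs1 : 0 < s + 1 := by linarith
  -- `g` telescopes to n^(s+1) and is itself asymptotic to (s+1) n^s, so f - c/(s+1) g = o(g). As g
  -- ≥ 0 has divergent sum, this passes to partial sums.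
  set g : ℕ → ℝ := fun n => ((n : ℝ) + 1) ^ (s + 1) - (n : ℝ) ^ (s + 1) with hg
  have hgs : ∀ n, ∑ k ∈ Finset.range n, g k = (n : ℝ) ^ (s + 1) := fun n => by
    have := Finset.sum_range_sub (fun k : ℕ => (k : ℝ) ^ (s + 1)) n
    simpa [hg, Real.zero_rpow hs1.ne'] using this
  have hg0 : 0 ≤ g := fun n => by
    have : (n : ℝ) ^ (s + 1) ≤ ((n : ℝ) + 1) ^ (s + 1) :=
      Real.rpow_le_rpow n.cast_nonneg (by linarith) hs1.le
    simpa [hg] using this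
  have hga : PowAsymp g s (s + 1) := (rpow_succ_sub (s + 1)).cast (by ring) rfl
  have hlim : Tendsto (fun n => (f n - c / (s + 1) * g n) / g n) atTop (𝓝 0) := by
    have h := ((hf.sub (hga.const_mul (c / (s + 1)))).div hga hs1.ne').cast (sub_self s)
      (by field_simp; simp : _ = (0 : ℝ))
    exact h.tendsto
  have hne : ∀ᶠ n in atTop, g n ≠ 0 := (hga.eventually_pos hs1).mono fun n hn => hn.ne'
  have ho : (fun n => f n - c / (s + 1) * g n) =o[atTop] g :=
    (Asymptotics.isLittleO_iff_tendsto' (hne.mono fun n hn h => absurd h hn)).2 hlim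
  have hsum := ho.sum_range hg0 (by
    simp only [hgs]
    exact (tendsto_rpow_atTop hs1).comp tendsto_natCast_atTop_atTop)
  simp only [hgs, Finset.sum_sub_distrib, ← Finset.mul_sum] at hsum
  have h2 : PowAsymp (fun n => ∑ k ∈ Finset.range n, f k - c / (s + 1) * (n : ℝ) ^ (s + 1))
    (s + 1) 0 := hsum.tendsto_div_nhds_zero
  have h3 := h2.add ((rpow (s + 1)).const_mul (c / (s + 1)))
  exact (h3.cast rfl (by simp)).congr' (.of_forall fun n => by simp)

/-- Alternating sums of a sequence of power growth are of smaller order than its sums. -/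
theorem alternating_sum (hf : PowAsymp f s c) (hs : -1 < s) :
    PowAsymp (fun n => ∑ k ∈ Finset.range n, (-1) ^ k * f k) (s + 1) 0 := by
  -- Summation by parts: the differences f k - f (k+1) are o(k^s), because both terms have the same
  -- leading coefficient. No regularity of `f` is needed.
  have h1 := (hf.sub hf.shift).cast rfl (sub_self c) |>.neg_one_pow_mul
  have h2 := (hf.of_lt (lt_add_one s)).neg_one_pow_mul
  have h3 : PowAsymp (fun _ => f 0) (s + 1) 0 := (const (f 0)).of_lt (by linarith)
  have h4 := (((h1.sum hs).cast rfl (by simp : _ = (0 : ℝ))).add (h3.sub h2)).const_mul (1 / 2)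
  refine (h4.cast rfl (by simp)).congr' (.of_forall fun n => ?_)
  have key : ∀ n, ∑ k ∈ Finset.range n, (-1) ^ k * (f k - f (k + 1))
      = 2 * (∑ k ∈ Finset.range n, (-1) ^ k * f k) - f 0 + (-1) ^ n * f n := fun n => by
    induction n with
    | zero => simp
    | succ n ih => rw [Finset.sum_range_succ, Finset.sum_range_succ, ih]; ring
  simp only [key]
  ring

theorem asympEq (hf : PowAsymp f s c) (hc : c ≠ 0) : AsympEq f (fun n => c * (n : ℝ) ^ s) := by
  have := Tendsto.div_const hf c
  rw [div_self hc] at this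
  exact this.congr fun n => by rw [div_div, mul_comm]

/-- `Γ(n + a) / n!` grows like `n ^ (a - 1)`. -/
theorem gamma_of_one_lt {a : ℝ} (ha : 1 < a) :
    PowAsymp (fun n => Real.Gamma (n + a) / n.factorial) (a - 1) 1 := by
  have hs : 0 < a - 1 := sub_pos.2 ha
  have hG := Real.Gamma_pos_of_pos hs
  have hprod : ∀ n : ℕ, Real.Gamma (n + a) =
      Real.Gamma (a - 1) * ∏ j ∈ Finset.range (n + 1), (a - 1 + j) := fun n => by
    induction n with
    | zero =>
      have := Real.Gamma_add_one hs.ne'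
      rw [sub_add_cancel] at this
      simp [this, mul_comm]
    | succ n ih =>
      rw [Finset.prod_range_succ, ← mul_assoc, ← ih, Nat.cast_succ, add_right_comm,
        Real.Gamma_add_one (by positivity)]
      ring
  -- Euler's limit formula at a - 1: the product in the denominator of `GammaSeq` is Γ(n+a)/Γ(a-1).
  have h := (tendsto_const_nhds (x := Real.Gamma (a - 1))).div
    (Real.GammaSeq_tendsto_Gamma (a - 1)) hG.ne'
  rw [div_self hG.ne'] at h
  refine h.congr fun n => ?_
  have : (0 : ℝ) < ∏ j ∈ Finset.range (n + 1), (a - 1 + j) :=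
    Finset.prod_pos fun j _ => by positivity
  simp only [Pi.div_apply, hprod]
  rw [Real.GammaSeq, div_div_eq_mul_div, div_div, mul_comm ((n : ℝ) ^ (a - 1))]

/-- The functional equation lowers `a` by one. Two applications extend a > 1 to a > -1, the range of
α + β + 1. -/
theorem gamma_of_add_one {a : ℝ}
    (h : PowAsymp (fun n => Real.Gamma (n + (a + 1)) / n.factorial) (a + 1 - 1) 1) :
    PowAsymp (fun n => Real.Gamma (n + a) / n.factorial) (a - 1) 1 := by
  refine ((h.div (natCast_add a) one_ne_zero).cast (by ring) (by simp)).congr' ?_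
  filter_upwards [eventually_gt_atTop ⌈-a⌉₊] with n hn
  have : 0 < (n : ℝ) + a := by linarith [Nat.lt_of_ceil_lt hn]
  rw [← add_assoc, Real.Gamma_add_one this.ne']
  field_simp

theorem gamma {a : ℝ} (ha : -1 < a) :
    PowAsymp (fun n => Real.Gamma (n + a) / n.factorial) (a - 1) 1 :=
  gamma_of_add_one (gamma_of_add_one (gamma_of_one_lt (by linarith)))

end PowAsymp

/-! ### Orthonormal sequences of a bilinear form and tests for orthogonality. -/

namespace IsOrthonormalPolySeq

variable {B : ℝ[X] →ₗ[ℝ] ℝ[X] →ₗ[ℝ] ℝ} {p : ℕ → ℝ[X]}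

theorem coeff_pos (hp : IsOrthonormalPolySeq (fun f g => B f g) p) (n : ℕ) :
    0 < (p n).coeff n := by
  have := hp.leadingCoeff_pos n
  rwa [leadingCoeff, hp.natDegree_eq] at this

theorem degree_eq (hp : IsOrthonormalPolySeq (fun f g => B f g) p) (n : ℕ) :
    (p n).degree = n := by
  rw [degree_eq_natDegree, hp.natDegree_eq]
  exact leadingCoeff_ne_zero.1 (hp.leadingCoeff_pos n).ne'

/-- Expansion of a polynomial in an orthonormal sequence. -/
theorem eq_sum (hp : IsOrthonormalPolySeq (fun f g => B f g) p) (n : ℕ) (f : ℝ[X])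
    (hf : f.degree < n) : f = ∑ k ∈ Finset.range n, B f (p k) • p k := by
  induction n generalizing f with
  | zero => simpa [Nat.WithBot.lt_zero_iff] using hf
  | succ n ih =>
    set c := f.coeff n / (p n).coeff n with hc
    have hg : (f - c • p n).degree < n := by
      rw [degree_lt_iff_coeff_zero]
      intro m hm
      rcases hm.eq_or_lt with rfl | hm
      · simp [hc, (hp.coeff_pos _).ne']
      · rw [coeff_sub, coeff_smul, coeff_eq_zero_of_degree_lt (hf.trans_le (by exact_mod_cast hm)),
          coeff_eq_zero_of_degree_lt ((hp.degree_eq n).trans_lt (by exact_mod_cast hm))]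
        simp
    have h1 := ih _ hg
    have h2 : ∀ k ∈ Finset.range n, B (f - c • p n) (p k) • p k = B f (p k) • p k := by
      intro k hk
      have := hp.orthogonal n k (Finset.mem_range.1 hk).ne'
      simp [this]
    rw [Finset.sum_congr rfl h2, sub_eq_iff_eq_add] at h1
    have h3 : B f (p n) = c := by
      have h4 : ∑ k ∈ Finset.range n, B f (p k) * B (p k) (p n) = 0 :=
        Finset.sum_eq_zero fun k hk => by
          rw [show B (p k) (p n) = 0 from hp.orthogonal k n (Finset.mem_range.1 hk).ne, mul_zero]
      have h5 : B (p n) (p n) = 1 := hp.normalized n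
      have h6 := congrArg (fun g => B g (p n)) h1
      simpa [h4, h5] using h6
    rw [Finset.sum_range_succ, h3]
    exact h1

theorem apply_eq_zero_of_degree_lt (hp : IsOrthonormalPolySeq (fun f g => B f g) p) {n : ℕ}
    {f : ℝ[X]} (hf : f.degree < n) : B (p n) f = 0 := by
  rw [hp.eq_sum n f hf, map_sum]
  refine Finset.sum_eq_zero fun k hk => ?_
  rw [map_smul, show B (p n) (p k) = 0 from hp.orthogonal n k (Finset.mem_range.1 hk).ne',
    smul_zero]

/-- A polynomial of degree `n` orthogonal to all those of smaller degree is a multiple of `p n`. -/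
theorem eq_smul_of_orthogonal (hp : IsOrthonormalPolySeq (fun f g => B f g) p) {n : ℕ} {f : ℝ[X]}
    (hf : f.degree < (n + 1 : ℕ)) (h : ∀ g : ℝ[X], g.degree < n → B f g = 0) :
    f = B f (p n) • p n := by
  conv_lhs => rw [hp.eq_sum (n + 1) f hf]
  rw [Finset.sum_range_succ, Finset.sum_eq_zero, zero_add]
  intro k hk
  rw [h _ ((hp.degree_eq k).trans_lt (by exact_mod_cast Finset.mem_range.1 hk)), zero_smul]

/-- Here f = c • p n, with c > 0 by comparison of leading coefficients, and then B f f = c². Thus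
any explicit orthogonal polynomial determines `p n`. -/
theorem evals_of_orthogonal (hp : IsOrthonormalPolySeq (fun f g => B f g) p) {n : ℕ} {f : ℝ[X]}
    (hf : f.degree < (n + 1 : ℕ)) (hpos : 0 < f.coeff n)
    (h : ∀ g : ℝ[X], g.degree < n → B f g = 0) :
    0 < B f f ∧ p n = (√(B f f))⁻¹ • f := by
  have h1 := hp.eq_smul_of_orthogonal hf h
  set c := B f (p n) with hc
  have h2 : f.coeff n = c * (p n).coeff n := by
    conv_lhs => rw [h1]
    simp
  have hc0 : 0 < c := by
    have := hp.coeff_pos n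
    rw [h2] at hpos
    exact (pos_iff_pos_of_mul_pos hpos).2 this
  have h5 : B (p n) (p n) = 1 := hp.normalized n
  have h3 : B f f = c ^ 2 := by
    rw [h1]
    simp [h5, sq]
  rw [h3]
  refine ⟨by positivity, ?_⟩
  rw [Real.sqrt_sq hc0.le]
  conv_rhs => rw [h1]
  rw [smul_smul, inv_mul_cancel₀ hc0.ne', one_smul]

end IsOrthonormalPolySeq

/-- A linear form vanishing at `(1 + X) ^ m` for all `m < n` vanishes at all polynomials of degree
less than `n`. -/
theorem apply_eq_zero_of_one_add_X_pow {L : ℝ[X] →ₗ[ℝ] ℝ} {n : ℕ}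
    (h : ∀ m < n, L ((1 + X) ^ m) = 0) {g : ℝ[X]} (hg : g.degree < n) : L g = 0 := by
  rw [← sum_taylor_eq g (-1), Polynomial.sum_def, map_sum]
  refine Finset.sum_eq_zero fun m hm => ?_
  have hm' : m < n := by
    have h1 := le_degree_of_mem_supp m hm
    rw [degree_taylor] at h1
    exact_mod_cast h1.trans_lt hg
  rw [← smul_eq_C_mul, map_smul, C_neg, C_1, sub_neg_eq_add, add_comm X, h m hm', smul_zero]

/-- Modulo lower degree, `f` is `f.coeff n` times the monic (1 + X)^n. This reduces the norm of a
Jacobi polynomial to one integral. -/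
theorem apply_eq_coeff_mul {L : ℝ[X] →ₗ[ℝ] ℝ} {n : ℕ}
    (h : ∀ m < n, L ((1 + X) ^ m) = 0) {f : ℝ[X]} (hf : f.degree < (n + 1 : ℕ)) :
    L f = f.coeff n * L ((1 + X) ^ n) := by
  have hd : ((1 + X : ℝ[X]) ^ n).natDegree = n := by
    rw [natDegree_pow, add_comm, ← C_1, natDegree_X_add_C, mul_one]
  have hm : ((1 + X : ℝ[X]) ^ n).coeff n = 1 := by
    have : ((1 + X : ℝ[X]) ^ n).Monic := by
      rw [add_comm, ← C_1]; exact (monic_X_add_C 1).pow n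
    rw [Monic, leadingCoeff, hd] at this
    exact this
  have hg : (f - f.coeff n • (1 + X) ^ n).degree < (n : WithBot ℕ) := by
    rw [degree_lt_iff_coeff_zero]
    intro m hm'
    rcases hm'.eq_or_lt with rfl | hm'
    · rw [coeff_sub, coeff_smul, hm]; simp
    · rw [coeff_sub, coeff_smul, coeff_eq_zero_of_degree_lt (hf.trans_le (by exact_mod_cast hm')),
        coeff_eq_zero_of_natDegree_lt (hd.trans_lt hm')]
      simp
  have := apply_eq_zero_of_one_add_X_pow h hg
  rwa [map_sub, map_smul, smul_eq_mul, sub_eq_zero] at this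

/-! ### The Jacobi weight: beta integrals, bilinear forms, reflection. -/

theorem intervalIntegrable_jacobiWeight {a b : ℝ} (ha : -1 < a) (hb : -1 < b) :
    IntervalIntegrable (fun x : ℝ => (1 - x) ^ a * (1 + x) ^ b) MeasureTheory.volume (-1) 1 := by
  -- Splitting at 0 leaves one singular endpoint in each half, and x ↦ -x exchanges the halves.
  have key : ∀ a b : ℝ, -1 < a → IntervalIntegrable (fun x : ℝ => (1 - x) ^ a * (1 + x) ^ b)
      MeasureTheory.volume 0 1 := fun a b ha => by
    have h1 : IntervalIntegrable (fun x : ℝ => (1 - x) ^ a) MeasureTheory.volume 0 1 := by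
      simpa using
        ((intervalIntegral.intervalIntegrable_rpow' (a := 0) (b := 1) ha).comp_sub_left 1).symm
    refine h1.mul_continuousOn ?_
    rw [Set.uIcc_of_le zero_le_one]
    intro x hx
    refine ContinuousWithinAt.rpow_const (by fun_prop) (Or.inl ?_)
    linarith [hx.1]
  have h2 := (key b a hb).comp_sub_left 0
  refine IntervalIntegrable.trans (b := 0) ?_ (key a b ha)
  simpa [mul_comm, ← sub_eq_add_neg] using h2.symm

theorem integral_jacobiWeight {a b : ℝ} (ha : -1 < a) (hb : -1 < b) :
    ∫ x in (-1 : ℝ)..1, (1 - x) ^ a * (1 + x) ^ b =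
      2 ^ (a + b + 1) * (Real.Gamma (a + 1) * Real.Gamma (b + 1) / Real.Gamma (a + b + 2)) := by
  -- The substitution y = 1 - x gives a beta integral scaled to [0, 2].
  have h := Complex.betaIntegral_scaled ((a + 1 : ℝ) : ℂ) ((b + 1 : ℝ) : ℂ) two_pos
  rw [Complex.betaIntegral_eq_Gamma_mul_div _ _ (by rw [Complex.ofReal_re]; linarith)
    (by rw [Complex.ofReal_re]; linarith)] at h
  have h2 := intervalIntegral.integral_comp_sub_left (a := -1) (b := 1)
    (fun y : ℝ => y ^ a * (2 - y) ^ b) 1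
  have h3 : ∀ x : ℝ, 2 - (1 - x) = 1 + x := fun x => by ring
  simp only [h3] at h2
  rw [h2, ← Complex.ofReal_inj, ← intervalIntegral.integral_ofReal]
  norm_num only
  refine Eq.trans ?_ (h.trans ?_)
  · refine intervalIntegral.integral_congr fun x hx => ?_
    rw [Set.uIcc_of_le zero_le_two] at hx
    have h4 : 0 ≤ 2 - x := by linarith [hx.2]
    simp only [Complex.ofReal_mul]
    rw [Complex.ofReal_cpow hx.1, Complex.ofReal_cpow h4]
    push_cast
    simp
  · rw [← Complex.ofReal_add, Complex.Gamma_ofReal, Complex.Gamma_ofReal, Complex.Gamma_ofReal,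
      Complex.ofReal_mul, Complex.ofReal_cpow two_pos.le, show a + 1 + (b + 1) = a + b + 2 by ring]
    push_cast
    congr 2
    ring

section Form

variable {α β : ℝ}

theorem intervalIntegrable_jacobiInner (hα : -1 < α) (hβ : -1 < β) (f g : ℝ[X]) :
    IntervalIntegrable (fun x => f.eval x * g.eval x * ((1 - x) ^ α * (1 + x) ^ β))
      MeasureTheory.volume (-1) 1 :=
  (intervalIntegrable_jacobiWeight hα hβ).continuousOn_mul (by fun_prop)

/-- The Jacobi inner product as a bilinear form. -/
noncomputable def jacobiForm (hα : -1 < α) (hβ : -1 < β) : ℝ[X] →ₗ[ℝ] ℝ[X] →ₗ[ℝ] ℝ :=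
  LinearMap.mk₂ ℝ (jacobiInner α β)
    (fun f₁ f₂ g => by
      rw [jacobiInner, jacobiInner, jacobiInner, ← intervalIntegral.integral_add
        (intervalIntegrable_jacobiInner hα hβ _ _) (intervalIntegrable_jacobiInner hα hβ _ _)]
      simp only [eval_add, add_mul])
    (fun c f g => by
      rw [jacobiInner, jacobiInner, smul_eq_mul, ← intervalIntegral.integral_const_mul]
      simp only [eval_smul, smul_eq_mul, mul_assoc])
    (fun f g₁ g₂ => by
      rw [jacobiInner, jacobiInner, jacobiInner, ← intervalIntegral.integral_add
        (intervalIntegrable_jacobiInner hα hβ _ _) (intervalIntegrable_jacobiInner hα hβ _ _)]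
      simp only [eval_add, add_mul, mul_add])
    (fun c f g => by
      rw [jacobiInner, jacobiInner, smul_eq_mul, ← intervalIntegral.integral_const_mul]
      simp only [eval_smul, smul_eq_mul, mul_assoc, mul_left_comm])

@[simp]
theorem jacobiForm_apply (hα : -1 < α) (hβ : -1 < β) (f g : ℝ[X]) :
    jacobiForm hα hβ f g = jacobiInner α β f g := rfl

/-- The Jacobi-Sobolev inner product as a bilinear form. -/
noncomputable def jacobiSobolevForm (hα : -1 < α) (hβ : -1 < β) (M N : ℝ) :
    ℝ[X] →ₗ[ℝ] ℝ[X] →ₗ[ℝ] ℝ :=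
  LinearMap.mk₂ ℝ (jacobiSobolevInner α β M N)
    (fun f₁ f₂ g => by
      simp only [jacobiSobolevInner, ← jacobiForm_apply hα hβ, map_add, LinearMap.add_apply,
        eval_add]
      ring)
    (fun c f g => by
      simp only [jacobiSobolevInner, ← jacobiForm_apply hα hβ, map_smul, LinearMap.smul_apply,
        eval_smul, smul_eq_mul]
      ring)
    (fun f g₁ g₂ => by
      simp only [jacobiSobolevInner, ← jacobiForm_apply hα hβ, map_add, eval_add]
      ring)
    (fun c f g => by
      simp only [jacobiSobolevInner, ← jacobiForm_apply hα hβ, map_smul, eval_smul, smul_eq_mul]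
      ring)

/-- The weight absorbs both powers, shifting its exponents to α + k and β + m. -/
theorem jacobiInner_pow_pow (hα : -1 < α) (hβ : -1 < β) (k m : ℕ) :
    jacobiInner α β ((1 - X) ^ k) ((1 + X) ^ m) = 2 ^ (α + β + 1 + k + m) *
      (Real.Gamma (α + 1 + k) * Real.Gamma (β + 1 + m) / Real.Gamma (α + β + 2 + k + m)) := by
  have hk : -1 < α + k := by linarith [k.cast_nonneg (α := ℝ)]
  have hm : -1 < β + m := by linarith [m.cast_nonneg (α := ℝ)]
  have h := integral_jacobiWeight hk hm
  rw [show α + k + (β + m) + 1 = α + β + 1 + k + m by ring,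
    show α + k + (β + m) + 2 = α + β + 2 + k + m by ring, 
    add_right_comm α (k : ℝ) 1, add_right_comm β (m : ℝ) 1] at h
  rw [← h, jacobiInner]
  refine intervalIntegral.integral_congr_Ioo_of_le (by norm_num) fun x hx => ?_
  have h1 : 0 < 1 - x := by linarith [hx.2]
  have h2 : 0 < 1 + x := by linarith [hx.1]
  simp only [eval_pow, eval_sub, eval_add, eval_one, eval_X, Real.rpow_add h1, Real.rpow_add h2,
    Real.rpow_natCast]
  ring

theorem jacobiInner_comp_neg_X (f g : ℝ[X]) :
    jacobiInner α β (f.comp (-X)) (g.comp (-X)) = jacobiInner β α f g := by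
  have h := intervalIntegral.integral_comp_neg (a := -1) (b := 1)
    (fun x : ℝ => f.eval x * g.eval x * ((1 - x) ^ β * (1 + x) ^ α))
  rw [neg_neg] at h
  rw [jacobiInner, jacobiInner, ← h]
  refine intervalIntegral.integral_congr fun x _ => ?_
  simp only [eval_comp, eval_neg, eval_X, sub_neg_eq_add, ← sub_eq_add_neg]
  ring

/-- The sign (-1)^n keeps the leading coefficient positive. Values at -1 thereby become values at 1
with α and β exchanged. -/
theorem IsOrthonormalPolySeq.reflect {p : ℕ → ℝ[X]}
    (hp : IsOrthonormalPolySeq (jacobiInner α β) p) :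
    IsOrthonormalPolySeq (jacobiInner β α) (fun n => C ((-1) ^ n) * (p n).comp (-X)) := by
  have hdeg : (-X : ℝ[X]).natDegree = 1 := by rw [natDegree_neg, natDegree_X]
  have hne : ∀ n : ℕ, (-1 : ℝ) ^ n ≠ 0 := fun n => pow_ne_zero n (by norm_num)
  have hin : ∀ m n, jacobiInner β α (C ((-1) ^ m) * (p m).comp (-X))
      (C ((-1) ^ n) * (p n).comp (-X)) = (-1) ^ m * (-1) ^ n * jacobiInner α β (p m) (p n) := by
    intro m n
    rw [← jacobiInner_comp_neg_X, jacobiInner, jacobiInner, ← intervalIntegral.integral_const_mul]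
    refine intervalIntegral.integral_congr fun x _ => ?_
    simp only [eval_comp, eval_neg, eval_X, eval_mul, eval_C, neg_neg]
    ring
  refine ⟨fun n => ?_, fun n => ?_, fun m n hmn => ?_, fun n => ?_⟩
  · rw [natDegree_C_mul (hne n), natDegree_comp, hdeg, hp.natDegree_eq, mul_one]
  · rw [leadingCoeff_mul, leadingCoeff_C, leadingCoeff_comp (by rw [hdeg]; exact one_ne_zero),
      leadingCoeff_neg, leadingCoeff_X, hp.natDegree_eq, mul_left_comm, ← mul_pow]
    simpa using hp.leadingCoeff_pos n
  · rw [hin, hp.orthogonal m n hmn, mul_zero]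
  · rw [hin, hp.normalized, ← mul_pow]
    simp

end Form

/-! ### Finite differences and the explicit Jacobi polynomial. -/

theorem sum_neg_one_pow_mul_choose_mul (f : ℝ → ℝ) (n : ℕ) (y : ℝ) :
    ∑ k ∈ Finset.range (n + 1), (-1) ^ k * (n.choose k : ℝ) * f (y + k) =
      (-1) ^ n * (fwdDiff 1)^[n] f y := by
  rw [fwdDiff_iter_eq_sum_shift, Finset.mul_sum]
  refine Finset.sum_congr rfl fun k hk => ?_
  have hk' : k ≤ n := Nat.lt_succ_iff.1 (Finset.mem_range.1 hk)
  have h : (-1 : ℝ) ^ n * (-1) ^ (n - k) = (-1) ^ k := by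
    obtain ⟨j, rfl⟩ := Nat.exists_eq_add_of_le hk'
    rw [Nat.add_sub_cancel_left, pow_add, mul_assoc, ← mul_pow]
    simp
  rw [← h, zsmul_eq_mul, nsmul_one]
  push_cast
  ring

theorem fwdDiff_iter_inv (n : ℕ) {x : ℝ} (hx : 0 < x) :
    (fwdDiff 1)^[n] (fun y : ℝ => y⁻¹) x =
      (-1) ^ n * n.factorial * Real.Gamma x / Real.Gamma (x + n + 1) := by
  induction n generalizing x with
  | zero =>
    have := (Real.Gamma_pos_of_pos hx).ne'
    simp only [Function.iterate_zero, id, Nat.cast_zero, add_zero, Real.Gamma_add_one hx.ne']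
    field_simp
    simp
  | succ n ih =>
    have h1 : 0 < x + n + 1 := by positivity
    have h2 := (Real.Gamma_pos_of_pos h1).ne'
    rw [Function.iterate_succ_apply', fwdDiff, ih hx, ih (by linarith), Real.Gamma_add_one hx.ne',
      Nat.cast_succ, ← add_assoc, show x + 1 + n + 1 = x + n + 1 + 1 by ring,
      Real.Gamma_add_one h1.ne', Nat.factorial_succ, Nat.cast_mul, Nat.cast_succ]
    field_simp
    ring

theorem Real.Gamma_add_natCast {z : ℝ} (hz : 0 < z) (j : ℕ) :
    Real.Gamma (z + j) = Real.Gamma z * (ascPochhammer ℝ j).eval z := by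
  induction j with
  | zero => simp
  | succ j ih =>
    rw [Nat.cast_succ, ← add_assoc, Real.Gamma_add_one (by positivity), ih,
      ascPochhammer_succ_eval]
    ring

/-- A multiple of the Jacobi polynomial of degree `n`, expanded around `1`. -/
noncomputable def jacobiPoly (α β : ℝ) (n : ℕ) : ℝ[X] :=
  ∑ k ∈ Finset.range (n + 1),
    (n.choose k * (Real.Gamma (n + α + β + 1 + k) / Real.Gamma (α + 1 + k)) / 2 ^ k : ℝ) •
      (X - C 1) ^ k

section

variable {α β : ℝ} {n : ℕ}

theorem degree_jacobiPoly_lt (α β : ℝ) (n : ℕ) : (jacobiPoly α β n).degree < (n + 1 : ℕ) := by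
  refine (degree_sum_le _ _).trans_lt
    ((Finset.sup_lt_iff (WithBot.bot_lt_coe _)).2 fun k hk => (degree_smul_le _ _).trans_lt ?_)
  rw [degree_pow, degree_X_sub_C, nsmul_one]
  exact_mod_cast Finset.mem_range.1 hk

theorem coeff_jacobiPoly (α β : ℝ) (n : ℕ) : (jacobiPoly α β n).coeff n =
    Real.Gamma (n + α + β + 1 + n) / Real.Gamma (α + 1 + n) / 2 ^ n := by
  rw [jacobiPoly, finsetSum_coeff, Finset.sum_range_succ, Finset.sum_eq_zero, zero_add, coeff_smul]
  · have h : ((X - C (1 : ℝ)) ^ n).Monic := (monic_X_sub_C 1).pow n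
    rw [Monic, leadingCoeff, natDegree_pow, natDegree_X_sub_C, mul_one] at h
    rw [h]
    simp
  · intro k hk
    rw [coeff_smul, coeff_eq_zero_of_natDegree_lt, smul_zero]
    rw [natDegree_pow, natDegree_X_sub_C, mul_one]
    exact Finset.mem_range.1 hk

theorem eval_jacobiPoly (α β : ℝ) (n : ℕ) :
    (jacobiPoly α β n).eval 1 = Real.Gamma (n + α + β + 1) / Real.Gamma (α + 1) := by
  rw [jacobiPoly, eval_finsetSum, Finset.sum_range_succ', Finset.sum_eq_zero]
  · simp
  · intro k _
    simp

theorem eval_derivative_jacobiPoly (hα : -1 < α) (h : 0 < n + α + β + 1) :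
    (derivative (jacobiPoly α β n)).eval 1 =
      n * (n + α + β + 1) / (2 * (α + 1)) * (jacobiPoly α β n).eval 1 := by
  rw [eval_jacobiPoly, jacobiPoly, derivative_sum, eval_finsetSum]
  rcases n with - | n
  · simp
  rw [Finset.sum_range_succ', Finset.sum_range_succ', Finset.sum_eq_zero]
  · have h1 : α + 1 ≠ 0 := by linarith
    have h2 : Real.Gamma (α + 1) ≠ 0 := (Real.Gamma_pos_of_pos (by linarith)).ne'
    have h3 := Real.Gamma_add_one h.ne'
    push_cast at h3
    simp [h3, Real.Gamma_add_one h1]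
    field_simp
  · intro k _
    simp [derivative_pow]

/-- The factor Γ(α+1+k) from the beta integral cancels the denominator of the k-th coefficient. What
remains is an n-th forward difference. -/
theorem jacobiInner_jacobiPoly (hα : -1 < α) (hβ : -1 < β) (m : ℕ) :
    jacobiInner α β (jacobiPoly α β n) ((1 + X) ^ m) =
      2 ^ (α + β + 1 + m) * Real.Gamma (β + 1 + m) *
        ∑ k ∈ Finset.range (n + 1), (-1) ^ k * (n.choose k : ℝ) *
          (Real.Gamma (n + α + β + 1 + k) / Real.Gamma (α + β + 2 + k + m)) := by
  rw [← jacobiForm_apply hα hβ, jacobiPoly, map_sum, LinearMap.sum_apply, Finset.mul_sum]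
  refine Finset.sum_congr rfl fun k _ => ?_
  have h1 : (X - C 1 : ℝ[X]) ^ k = ((-1 : ℝ) ^ k) • (1 - X) ^ k := by
    rw [smul_eq_C_mul, C_pow, ← mul_pow]
    simp
  have h2 := (Real.Gamma_pos_of_pos (by linarith [k.cast_nonneg (α := ℝ)] : 0 < α + 1 + k)).ne'
  rw [h1, map_smul, map_smul, LinearMap.smul_apply, LinearMap.smul_apply, jacobiForm_apply,
    jacobiInner_pow_pow hα hβ, smul_eq_mul, smul_eq_mul, add_right_comm _ (k : ℝ) (m : ℝ),
    Real.rpow_add two_pos _ (k : ℝ), Real.rpow_natCast]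
  field_simp

/-- For m < n the gamma quotient is a polynomial in k of degree n - 1 - m, which the n-th difference
annihilates. -/
theorem jacobiInner_jacobiPoly_of_lt (hα : -1 < α) (hβ : -1 < β) {m : ℕ} (hm : m < n) :
    jacobiInner α β (jacobiPoly α β n) ((1 + X) ^ m) = 0 := by
  obtain ⟨j, rfl⟩ := Nat.exists_eq_add_of_lt hm
  have h1 : 0 < α + β + 2 + m := by linarith [m.cast_nonneg (α := ℝ)]
  have h : ∀ k : ℕ, Real.Gamma (((m + j + 1 : ℕ) : ℝ) + α + β + 1 + k) /
      Real.Gamma (α + β + 2 + k + m) = (ascPochhammer ℝ j).eval (α + β + 2 + m + k) := fun k => by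
    have h2 : 0 < α + β + 2 + m + k := by positivity
    rw [show ((m + j + 1 : ℕ) : ℝ) + α + β + 1 + k = α + β + 2 + m + k + j by push_cast; ring,
      Real.Gamma_add_natCast h2, add_right_comm _ (k : ℝ) (m : ℝ),
      mul_div_cancel_left₀ _ (Real.Gamma_pos_of_pos h2).ne']
  simp only [jacobiInner_jacobiPoly hα hβ, h]
  rw [sum_neg_one_pow_mul_choose_mul (fun y => (ascPochhammer ℝ j).eval y),
    fwdDiff_iter_eq_zero_of_degree_lt]
  · simp
  · rw [ascPochhammer_natDegree]
    omega

/-- For m = n the quotient collapses to 1/(n+α+β+1+k), whose n-th difference is explicit. Condition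
`h` can fail only at n = 0, which is harmless for asymptotics. -/
theorem jacobiInner_jacobiPoly_self_pow (hα : -1 < α) (hβ : -1 < β) (h : 0 < n + α + β + 1) :
    jacobiInner α β (jacobiPoly α β n) ((1 + X) ^ n) =
      2 ^ (α + β + 1 + n) * Real.Gamma (β + 1 + n) *
        (n.factorial * Real.Gamma (n + α + β + 1) / Real.Gamma (n + α + β + 1 + n + 1)) := by
  have h1 : ∀ k : ℕ, Real.Gamma (n + α + β + 1 + k) / Real.Gamma (α + β + 2 + k + n) =
      (n + α + β + 1 + k)⁻¹ := fun k => by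
    have h2 : 0 < n + α + β + 1 + k := by positivity
    rw [show α + β + 2 + k + n = n + α + β + 1 + k + 1 by ring, Real.Gamma_add_one h2.ne']
    have := (Real.Gamma_pos_of_pos h2).ne'
    field_simp
  simp only [jacobiInner_jacobiPoly hα hβ, h1]
  rw [sum_neg_one_pow_mul_choose_mul (fun y => y⁻¹), fwdDiff_iter_inv n h, mul_div_assoc,
    mul_assoc ((-1) ^ n), ← mul_assoc ((-1) ^ n), ← mul_pow]
  simp [mul_div_assoc]

theorem jacobiInner_jacobiPoly_self (hα : -1 < α) (hβ : -1 < β) (h : 0 < n + α + β + 1) :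
    jacobiInner α β (jacobiPoly α β n) (jacobiPoly α β n) =
      2 ^ (α + β + 1) * n.factorial * Real.Gamma (β + 1 + n) * Real.Gamma (n + α + β + 1) /
        (Real.Gamma (α + 1 + n) * (n + α + β + 1 + n)) := by
  have h2 : 0 < n + α + β + 1 + n := by positivity
  have h3 := (Real.Gamma_pos_of_pos h2).ne'
  rw [← jacobiForm_apply hα hβ, apply_eq_coeff_mul (n := n)
    (fun m hm => jacobiInner_jacobiPoly_of_lt hα hβ hm) (degree_jacobiPoly_lt α β n),
    jacobiForm_apply, jacobiInner_jacobiPoly_self_pow hα hβ h, coeff_jacobiPoly,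
    Real.Gamma_add_one h2.ne', Real.rpow_add two_pos, Real.rpow_natCast]
  field_simp

/-! ### Orthonormal Jacobi polynomials at the endpoint 1. -/

variable {p : ℕ → ℝ[X]}

theorem IsOrthonormalPolySeq.eval_one_pos_and_sq (hα : -1 < α) (hβ : -1 < β)
    (hp : IsOrthonormalPolySeq (jacobiInner α β) p) (h : 0 < n + α + β + 1) :
    0 < (p n).eval 1 ∧
    (p n).eval 1 ^ 2 = Real.Gamma (n + α + β + 1) * Real.Gamma (α + 1 + n) * (n + α + β + 1 + n) /
      (2 ^ (α + β + 1) * Real.Gamma (α + 1) ^ 2 * n.factorial * Real.Gamma (β + 1 + n)) ∧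
    (derivative (p n)).eval 1 = n * (n + α + β + 1) / (2 * (α + 1)) * (p n).eval 1 := by
  have g1 := Real.Gamma_pos_of_pos h
  have g2 := Real.Gamma_pos_of_pos (by linarith : 0 < α + 1)
  have g3 := Real.Gamma_pos_of_pos (by linarith [n.cast_nonneg (α := ℝ)] : 0 < α + 1 + n)
  have g4 := Real.Gamma_pos_of_pos (by linarith [n.cast_nonneg (α := ℝ)] : 0 < β + 1 + n)
  have g5 : 0 < n + α + β + 1 + n := by positivity
  have hp' : IsOrthonormalPolySeq (fun f g => jacobiForm hα hβ f g) p := hp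
  obtain ⟨hpos, heq⟩ := hp'.evals_of_orthogonal (degree_jacobiPoly_lt α β n)
    (by rw [coeff_jacobiPoly]; have := Real.Gamma_pos_of_pos g5; positivity)
    (fun g hg => apply_eq_zero_of_one_add_X_pow
      (fun m hm => jacobiInner_jacobiPoly_of_lt hα hβ hm) hg)
  rw [jacobiForm_apply] at hpos heq
  refine ⟨?_, ?_, ?_⟩
  · rw [heq, eval_smul, eval_jacobiPoly, smul_eq_mul]
    positivity
  · rw [heq, eval_smul, eval_jacobiPoly, smul_eq_mul, mul_pow, inv_pow, Real.sq_sqrt hpos.le,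
      jacobiInner_jacobiPoly_self hα hβ h]
    field_simp
  · rw [heq, derivative_smul, eval_smul, eval_smul, eval_derivative_jacobiPoly hα h, smul_eq_mul,
      smul_eq_mul]
    ring

/-- The constant in the asymptotics of the orthonormal Jacobi polynomials at `1`. -/
noncomputable def jacobiConst (α β : ℝ) : ℝ :=
  √(2 / (2 ^ (α + β + 1) * Real.Gamma (α + 1) ^ 2))

theorem jacobiConst_pos (hα : -1 < α) (β : ℝ) : 0 < jacobiConst α β := by
  have := Real.Gamma_pos_of_pos (by linarith : 0 < α + 1)
  unfold jacobiConst
  positivity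

theorem eventually_natCast_add_pos (a : ℝ) : ∀ᶠ n : ℕ in atTop, 0 < (n : ℝ) + a :=
  (PowAsymp.natCast_add a).eventually_pos one_pos

theorem IsOrthonormalPolySeq.powAsymp_eval_one (hα : -1 < α) (hβ : -1 < β)
    (hp : IsOrthonormalPolySeq (jacobiInner α β) p) :
    PowAsymp (fun n => (p n).eval 1) (α + 1 / 2) (jacobiConst α β) := by
  have hpos := eventually_natCast_add_pos (α + β + 1)
  simp only [← add_assoc] at hpos
  have h1 := PowAsymp.gamma (a := α + β + 1) (by linarith)
  have h2 := PowAsymp.gamma (a := α + 1) (by linarith)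
  have h3 := PowAsymp.gamma (a := β + 1) (by linarith)
  have h4 := (PowAsymp.natCast_add (α + β + 1)).add (PowAsymp.natCast_add 0)
  -- The exponents add up to (α+β) + α + 1 - β = 2(α + 1/2); the coefficient 2 comes from the factor
  -- 2n + α + β + 1.
  have h5 := (((h1.mul h2).mul h4).div h3 one_ne_zero).const_mul
    (2 ^ (α + β + 1) * Real.Gamma (α + 1) ^ 2)⁻¹
  refine PowAsymp.of_sq ((h5.cast (t := 2 * (α + 1 / 2)) (by ring)
    (by rw [div_one, one_mul, one_mul, div_eq_inv_mul, one_add_one_eq_two])).congr' ?_) ?_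
  · filter_upwards [hpos] with n hn
    have g4 := Real.Gamma_pos_of_pos (by linarith [n.cast_nonneg (α := ℝ)] : 0 < β + 1 + n)
    rw [(hp.eval_one_pos_and_sq hα hβ hn).2.1]
    simp only [add_comm (n : ℝ) (β + 1), add_comm (n : ℝ) (α + 1), ← add_assoc, add_zero]
    field_simp
  · filter_upwards [hpos] with n hn using (hp.eval_one_pos_and_sq hα hβ hn).1.le

theorem IsOrthonormalPolySeq.powAsymp_eval_derivative_one (hα : -1 < α) (hβ : -1 < β)
    (hp : IsOrthonormalPolySeq (jacobiInner α β) p) :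
    PowAsymp (fun n => (derivative (p n)).eval 1) (α + 5 / 2)
      (jacobiConst α β / (2 * (α + 1))) := by
  have hpos := eventually_natCast_add_pos (α + β + 1)
  simp only [← add_assoc] at hpos
  have h1 := (((PowAsymp.natCast_add 0).mul (PowAsymp.natCast_add (α + β + 1))).mul
    (hp.powAsymp_eval_one hα hβ)).const_mul (2 * (α + 1))⁻¹
  refine (h1.cast (by ring) (by ring)).congr' ?_
  filter_upwards [hpos] with n hn
  rw [(hp.eval_one_pos_and_sq hα hβ hn).2.2]
  ring

end

/-! ### The Sobolev perturbation: expansion and linear system at 1. -/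

/-- Expansion of the orthonormal Jacobi-Sobolev polynomials in the orthonormal Jacobi ones. -/
theorem IsOrthonormalPolySeq.sobolev_expansion {α β M N : ℝ} (hα : -1 < α) (hβ : -1 < β)
    {p q : ℕ → ℝ[X]} (hp : IsOrthonormalPolySeq (jacobiInner α β) p)
    (hq : IsOrthonormalPolySeq (jacobiSobolevInner α β M N) q) (n : ℕ) :
    ∃ γ : ℝ, 0 < γ ∧
      γ * (γ + M * ((q n).eval 1 * (p n).eval 1) +
        N * ((derivative (q n)).eval 1 * (derivative (p n)).eval 1)) = 1 ∧
      ∀ L : ℝ[X] →ₗ[ℝ] ℝ, L (q n) = γ * L (p n)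
        - M * (q n).eval 1 * ∑ k ∈ Finset.range n, (p k).eval 1 * L (p k)
        - N * (derivative (q n)).eval 1 *
            ∑ k ∈ Finset.range n, (derivative (p k)).eval 1 * L (p k) := by
  have hp' : IsOrthonormalPolySeq (fun f g => jacobiForm hα hβ f g) p := hp
  have hq' : IsOrthonormalPolySeq (fun f g => jacobiSobolevForm hα hβ M N f g) q := hq
  have horth : ∀ k ∈ Finset.range n, jacobiSobolevForm hα hβ M N (q n) (p k) = 0 := fun k hk =>
    hq'.apply_eq_zero_of_degree_lt
      ((hp'.degree_eq k).trans_lt (by exact_mod_cast Finset.mem_range.1 hk))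
  have hexp := hp'.eq_sum (n + 1) (q n)
    ((hq'.degree_eq n).trans_lt (by exact_mod_cast n.lt_succ_self))
  rw [Finset.sum_range_succ] at hexp
  set γ := jacobiForm hα hβ (q n) (p n) with hγ
  refine ⟨γ, ?_, ?_, fun L => ?_⟩
  -- γ is the ratio of the leading coefficients of `q n` and `p n`.
  · have h1 := congrArg (fun f => f.coeff n) hexp
    have h2 : ∑ k ∈ Finset.range n, jacobiForm hα hβ (q n) (p k) * (p k).coeff n = 0 :=
      Finset.sum_eq_zero fun k hk => by
        rw [coeff_eq_zero_of_degree_lt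
          ((hp'.degree_eq k).trans_lt (by exact_mod_cast Finset.mem_range.1 hk)), mul_zero]
    simp only [coeff_add, finsetSum_coeff, coeff_smul, smul_eq_mul, h2, zero_add] at h1
    have h3 := hq'.coeff_pos n
    rw [h1] at h3
    exact (pos_iff_pos_of_mul_pos h3).2 (hp'.coeff_pos n)
  -- Pairing `q n` with its own expansion kills all terms but γ ⟨q_n, p_n⟩, which must equal 1.
  · have h1 := congrArg (jacobiSobolevForm hα hβ M N (q n)) hexp
    rw [map_add, map_sum, Finset.sum_eq_zero fun k hk => by
      rw [map_smul, horth k hk, smul_zero], zero_add, map_smul, smul_eq_mul,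
      show jacobiSobolevForm hα hβ M N (q n) (q n) = 1 from hq.normalized n] at h1
    exact h1.symm
  · have h1 := congrArg L hexp
    rw [map_add, map_sum, map_smul, smul_eq_mul] at h1
    rw [h1, add_comm, sub_sub, sub_eq_add_neg, Finset.mul_sum, Finset.mul_sum,
      ← Finset.sum_add_distrib, ← Finset.sum_neg_distrib]
    congr 1
    refine Finset.sum_congr rfl fun k hk => ?_
    have h2 : jacobiForm hα hβ (q n) (p k) + M * ((q n).eval 1 * (p k).eval 1) +
      N * ((derivative (q n)).eval 1 * (derivative (p k)).eval 1) = 0 := horth k hk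
    rw [map_smul, smul_eq_mul]
    linear_combination L (p k) * h2

/-- The determinant of the linear system for the values at `1` of a Sobolev-type perturbation of
an orthonormal sequence with values `a k` and derivatives `b k` at `1`. -/
noncomputable def sobolevDet (M N : ℝ) (a b : ℕ → ℝ) (n : ℕ) : ℝ :=
  (1 + M * ∑ k ∈ Finset.range n, a k * a k) * (1 + N * ∑ k ∈ Finset.range n, b k * b k) -
    M * N * (∑ k ∈ Finset.range n, a k * b k) ^ 2

/-- The solution of that system for the value at `1`, up to normalization. -/
noncomputable def sobolevValue (M N : ℝ) (a b : ℕ → ℝ) (n : ℕ) : ℝ :=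
  (a n * (1 + N * ∑ k ∈ Finset.range n, b k * b k) -
    N * (∑ k ∈ Finset.range n, a k * b k) * b n) / sobolevDet M N a b n

/-- The solution of that system for the derivative at `1`, up to normalization. -/
noncomputable def sobolevDeriv (M N : ℝ) (a b : ℕ → ℝ) (n : ℕ) : ℝ :=
  ((1 + M * ∑ k ∈ Finset.range n, a k * a k) * b n -
    M * (∑ k ∈ Finset.range n, a k * b k) * a n) / sobolevDet M N a b n

/-- The constants precede `a` and `b` so that they do not depend on the sequences. The determinant
is governed by MN(Σa² Σb² - (Σab)²), and its leading coefficient is positive because 1/((α+1)(α+3))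
- 1/(α+2)² = 1/((α+1)(α+2)²(α+3)). -/
theorem exists_sobolev_powAsymp_of_pos {α M N A B : ℝ} (hα : -1 < α) (hM : 0 < M) (hN : 0 < N)
    (hA : 0 < A) (hB : 0 < B) :
    ∃ c d : ℝ, 0 < c ∧ 0 < d ∧ ∀ a b : ℕ → ℝ, PowAsymp a (α + 1 / 2) A →
      PowAsymp b (α + 5 / 2) B →
      (∀ᶠ n in atTop, 0 < sobolevDet M N a b n) ∧
      PowAsymp (sobolevValue M N a b) (-α - 3 / 2) (-c) ∧
      PowAsymp (sobolevDeriv M N a b) (-α - 7 / 2) d := by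
  have e1 : 0 < α + 1 := by linarith
  have e2 : 0 < α + 2 := by linarith
  have e3 : 0 < α + 3 := by linarith
  refine ⟨N * A * B ^ 2 / (2 * (α + 2) * (α + 3)) /
      (M * N * A ^ 2 * B ^ 2 / (4 * (α + 1) * (α + 2) ^ 2 * (α + 3))),
    M * A ^ 2 * B / (2 * (α + 1) * (α + 2)) /
      (M * N * A ^ 2 * B ^ 2 / (4 * (α + 1) * (α + 2) ^ 2 * (α + 3))),
    by positivity, by positivity, fun a b ha hb => ?_⟩
  have s00 := ((ha.mul ha).sum (by linarith)).cast (t := 2 * α + 2) (d := A ^ 2 / (2 * (α + 1)))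
    (by ring) (by rw [show α + 1 / 2 + (α + 1 / 2) + 1 = 2 * (α + 1) by ring]; ring)
  have s01 := ((ha.mul hb).sum (by linarith)).cast (t := 2 * α + 4) (d := A * B / (2 * (α + 2)))
    (by ring) (by rw [show α + 1 / 2 + (α + 5 / 2) + 1 = 2 * (α + 2) by ring])
  have s11 := ((hb.mul hb).sum (by linarith)).cast (t := 2 * α + 6) (d := B ^ 2 / (2 * (α + 3)))
    (by ring) (by rw [show α + 5 / 2 + (α + 5 / 2) + 1 = 2 * (α + 3) by ring]; ring)
  have hdet : PowAsymp (sobolevDet M N a b) (4 * α + 8)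
      (M * N * A ^ 2 * B ^ 2 / (4 * (α + 1) * (α + 2) ^ 2 * (α + 3))) := by
    have h1 := (((s00.mul s11).sub (((s01.mul s01)).cast (by ring) rfl)).const_mul (M * N)).cast
      (t := 4 * α + 8)
      (d := M * N * A ^ 2 * B ^ 2 / (4 * (α + 1) * (α + 2) ^ 2 * (α + 3)))
      (by ring) (by field_simp; ring)
    have h2 := ((h1.add_of_lt (s00.const_mul M) (by linarith)).add_of_lt (s11.const_mul N)
      (by linarith)).add_of_lt (PowAsymp.const 1) (by linarith)
    refine h2.congr' (.of_forall fun n => ?_)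
    simp only [sobolevDet]
    ring
  refine ⟨hdet.eventually_pos (by positivity), ?_, ?_⟩
  -- The minus sign of q_n(1) originates here: 1/(α+3) - 1/(α+2) < 0.
  · have h1 := (((ha.mul s11).sub ((s01.mul hb).cast (by ring) rfl)).const_mul N).cast
      (t := 3 * α + 13 / 2) (d := -(N * A * B ^ 2 / (2 * (α + 2) * (α + 3))))
      (by ring) (by field_simp; ring)
    refine (((h1.add_of_lt ha (by linarith)).div hdet (by positivity)).cast (by ring)
      (by ring)).congr' (.of_forall fun n => ?_)
    simp only [sobolevValue]
    ring
  · have h1 := (((s00.mul hb).sub ((s01.mul ha).cast (by ring) rfl)).const_mul M).cast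
      (t := 3 * α + 9 / 2) (d := M * A ^ 2 * B / (2 * (α + 1) * (α + 2)))
      (by ring) (by field_simp; ring)
    refine (((h1.add_of_lt hb (by linarith)).div hdet (by positivity)).cast (by ring)
      rfl).congr' (.of_forall fun n => ?_)
    simp only [sobolevDeriv]
    ring

/-- The determinant is now only 1 + N Σb², of order 2α + 6, while the numerator of the value is
unchanged. Hence the larger order α + 1/2. -/
theorem exists_sobolev_powAsymp_of_eq_zero {α N A B : ℝ} (hα : -1 < α) (hN : 0 < N)
    (hA : 0 < A) (hB : 0 < B) :
    ∃ c d : ℝ, 0 < c ∧ 0 < d ∧ ∀ a b : ℕ → ℝ, PowAsymp a (α + 1 / 2) A →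
      PowAsymp b (α + 5 / 2) B →
      (∀ᶠ n in atTop, 0 < sobolevDet 0 N a b n) ∧
      PowAsymp (sobolevValue 0 N a b) (α + 1 / 2) (-c) ∧
      PowAsymp (sobolevDeriv 0 N a b) (-α - 7 / 2) d := by
  have e2 : 0 < α + 2 := by linarith
  have e3 : 0 < α + 3 := by linarith
  refine ⟨N * A * B ^ 2 / (2 * (α + 2) * (α + 3)) / (N * B ^ 2 / (2 * (α + 3))),
    B / (N * B ^ 2 / (2 * (α + 3))), by positivity, by positivity, fun a b ha hb => ?_⟩
  have s01 := ((ha.mul hb).sum (by linarith)).cast (t := 2 * α + 4) (d := A * B / (2 * (α + 2)))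
    (by ring) (by rw [show α + 1 / 2 + (α + 5 / 2) + 1 = 2 * (α + 2) by ring])
  have s11 := ((hb.mul hb).sum (by linarith)).cast (t := 2 * α + 6) (d := B ^ 2 / (2 * (α + 3)))
    (by ring) (by rw [show α + 5 / 2 + (α + 5 / 2) + 1 = 2 * (α + 3) by ring]; ring)
  have hdet : PowAsymp (sobolevDet 0 N a b) (2 * α + 6) (N * B ^ 2 / (2 * (α + 3))) := by
    refine (((s11.const_mul N).add_of_lt (PowAsymp.const 1) (by linarith)).cast rfl
      (by ring)).congr' (.of_forall fun n => ?_)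
    simp only [sobolevDet]
    ring
  refine ⟨hdet.eventually_pos (by positivity), ?_, ?_⟩
  · have h1 := (((ha.mul s11).sub ((s01.mul hb).cast (by ring) rfl)).const_mul N).cast
      (t := 3 * α + 13 / 2) (d := -(N * A * B ^ 2 / (2 * (α + 2) * (α + 3))))
      (by ring) (by field_simp; ring)
    refine (((h1.add_of_lt ha (by linarith)).div hdet (by positivity)).cast (by ring)
      (by ring)).congr' (.of_forall fun n => ?_)
    simp only [sobolevValue]
    ring
  · refine ((hb.div hdet (by positivity)).cast (by ring) rfl).congr' (.of_forall fun n => ?_)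
    simp only [sobolevDeriv]
    ring

/-- Cramer's rule: each combination of the two equations eliminates one unknown. -/
theorem sobolev_solution {M N u v γ : ℝ} {a b : ℕ → ℝ} {n : ℕ} (hdet : 0 < sobolevDet M N a b n)
    (hu : u = γ * a n - M * u * ∑ k ∈ Finset.range n, a k * a k -
      N * v * ∑ k ∈ Finset.range n, b k * a k)
    (hv : v = γ * b n - M * u * ∑ k ∈ Finset.range n, a k * b k -
      N * v * ∑ k ∈ Finset.range n, b k * b k) :
    u = γ * sobolevValue M N a b n ∧ v = γ * sobolevDeriv M N a b n := by
  simp only [mul_comm (b _) (a _)] at hu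
  rw [sobolevValue, sobolevDeriv, ← mul_div_assoc, ← mul_div_assoc, eq_div_iff hdet.ne',
    eq_div_iff hdet.ne', sobolevDet]
  constructor
  · linear_combination (1 + N * ∑ k ∈ Finset.range n, b k * b k) * hu -
      N * (∑ k ∈ Finset.range n, a k * b k) * hv
  · linear_combination (1 + M * ∑ k ∈ Finset.range n, a k * a k) * hv -
      M * (∑ k ∈ Finset.range n, a k * b k) * hu

theorem exists_sobolev_powAsymp {α M N A B : ℝ} (hα : -1 < α) (hM : 0 ≤ M) (hN : 0 < N)
    (hA : 0 < A) (hB : 0 < B) :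
    ∃ c d : ℝ, 0 < c ∧ 0 < d ∧ ∀ a b : ℕ → ℝ, PowAsymp a (α + 1 / 2) A →
      PowAsymp b (α + 5 / 2) B →
      (∀ᶠ n in atTop, 0 < sobolevDet M N a b n) ∧
      (0 < M → PowAsymp (sobolevValue M N a b) (-α - 3 / 2) (-c)) ∧
      (M = 0 → PowAsymp (sobolevValue M N a b) (α + 1 / 2) (-c)) ∧
      PowAsymp (sobolevDeriv M N a b) (-α - 7 / 2) d := by
  rcases hM.eq_or_lt with rfl | hM
  · obtain ⟨c, d, hc, hd, h⟩ := exists_sobolev_powAsymp_of_eq_zero hα hN hA hB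
    exact ⟨c, d, hc, hd, fun a b ha hb => ⟨(h a b ha hb).1, fun h0 => absurd h0 (lt_irrefl 0),
      fun _ => (h a b ha hb).2.1, (h a b ha hb).2.2⟩⟩
  · obtain ⟨c, d, hc, hd, h⟩ := exists_sobolev_powAsymp_of_pos hα hM hN hA hB
    exact ⟨c, d, hc, hd, fun a b ha hb => ⟨(h a b ha hb).1, fun _ => (h a b ha hb).2.1,
      fun h0 => absurd h0 hM.ne', (h a b ha hb).2.2⟩⟩

/-! ### Limit of γ, values at -1, and the final assembly. -/

theorem tendsto_one_of_sq_mul_tendsto_one {γ w : ℕ → ℝ} (hγ : ∀ n, 0 < γ n)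
    (hw : Tendsto w atTop (𝓝 1)) (h : ∀ᶠ n in atTop, γ n ^ 2 * w n = 1) :
    Tendsto γ atTop (𝓝 1) := by
  have h1 := (hw.inv₀ one_ne_zero).sqrt
  rw [inv_one, Real.sqrt_one] at h1
  refine h1.congr' (h.mono fun n hn => ?_)
  rw [← eq_inv_of_mul_eq_one_left hn, Real.sqrt_sq (hγ n).le]

/-- At points other than `1`, the values of the perturbed polynomials are asymptotically those of
the original ones: `w` and `z` stand for these values, with alternating signs. -/
theorem asympEq_of_alternating {α σ F A B M N m d : ℝ} {a b f x y γ w z : ℕ → ℝ}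
    (hσ : -1 < α + 1 / 2 + σ) (hF : 0 < F) (ha : PowAsymp a (α + 1 / 2) A)
    (hb : PowAsymp b (α + 5 / 2) B) (hf : PowAsymp f σ F)
    (hx : PowAsymp (fun n => M * x n) (-α - 3 / 2) m) (hy : PowAsymp y (-α - 7 / 2) d)
    (hγ : Tendsto γ atTop (𝓝 1)) (j : ℕ) (hz : ∀ n, z n = (-1) ^ (n + j) * f n)
    (hw : ∀ᶠ n in atTop, w n = γ n * z n
      - M * (γ n * x n) * ∑ k ∈ Finset.range n, a k * z k
      - N * (γ n * y n) * ∑ k ∈ Finset.range n, b k * z k) :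
    AsympEq w z := by
  -- Both corrections have exponent exactly σ, that of `f`; only the vanishing limits of the
  -- alternating sums make them negligible.
  have h0 := (hx.mul ((ha.mul hf).alternating_sum hσ)).cast (t := σ) (by ring) (mul_zero m)
  have h1 := ((hy.mul ((hb.mul hf).alternating_sum (by linarith))).const_mul N).cast
    (t := σ) (d := 0) (by ring) (by ring)
  have h2 := ((h0.add h1).cast rfl (add_zero 0)).neg_one_pow_mul
  have h3 := ((PowAsymp.of_tendsto hγ).mul ((hf.sub h2).cast rfl (sub_zero F))).div hf hF.ne'
  refine ((h3.cast (by ring) (by field_simp : _ = (1 : ℝ))).congr' ?_).tendsto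
  filter_upwards [hw, hf.eventually_pos hF] with n hn hfn
  have hs : ((-1 : ℝ) ^ n) ^ 2 = 1 := by rw [← pow_mul, mul_comm, pow_mul]; simp
  have hsum : ∀ c : ℕ → ℝ, ∑ k ∈ Finset.range n, c k * z k =
      (-1) ^ j * ∑ k ∈ Finset.range n, (-1) ^ k * (c k * f k) := fun c => by
    rw [Finset.mul_sum]
    refine Finset.sum_congr rfl fun k _ => ?_
    rw [hz, pow_add]
    ring
  have hz0 : z n ≠ 0 := by
    rw [hz]
    exact mul_ne_zero (pow_ne_zero _ (by norm_num)) hfn.ne'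
  rw [hn, hsum, hsum, div_eq_div_iff hfn.ne' hz0, hz, pow_add]
  linear_combination (-f n * γ n * (-1) ^ j *
    (M * x n * (∑ k ∈ Finset.range n, (-1) ^ k * (a k * f k)) +
    N * (y n * ∑ k ∈ Finset.range n, (-1) ^ k * (b k * f k)))) * hs

theorem PowAsymp.asympEq_mul_neg_one_pow {f z : ℕ → ℝ} {σ F : ℝ} (hf : PowAsymp f σ F)
    (hF : F ≠ 0) (j : ℕ) (hz : ∀ n, z n = (-1) ^ (n + j) * f n) :
    AsympEq z (fun n => F * (-1) ^ (n + j) * (n : ℝ) ^ σ) := by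
  refine Tendsto.congr (fun n => ?_) (hf.asympEq hF)
  have : (-1 : ℝ) ^ (n + j) ≠ 0 := pow_ne_zero _ (by norm_num)
  simp only [hz]
  rw [mul_right_comm, mul_comm ((-1) ^ (n + j)), mul_div_mul_right _ _ this]

theorem theorem2 (α β M N : ℝ) (hα : -1 < α) (hβ : -1 < β) (hM : 0 ≤ M) (hN : 0 < N) :
    ∃ C₁ C₂ C₃ C₄ : ℝ, 0 < C₁ ∧ 0 < C₂ ∧ 0 < C₃ ∧ 0 < C₄ ∧
      ∀ p q : ℕ → ℝ[X],
        IsOrthonormalPolySeq (jacobiInner α β) p →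
        IsOrthonormalPolySeq (jacobiSobolevInner α β M N) q →
          AsympEq (fun n => (q n).eval (-1)) (fun n => (p n).eval (-1)) ∧
          AsympEq (fun n => (p n).eval (-1))
            (fun n => C₁ * (-1 : ℝ) ^ n * (n : ℝ) ^ (β + 1 / 2)) ∧
          AsympEq (fun n => (derivative (q n)).eval (-1))
            (fun n => (derivative (p n)).eval (-1)) ∧
          AsympEq (fun n => (derivative (p n)).eval (-1))
            (fun n => C₂ * (-1 : ℝ) ^ (n + 1) * (n : ℝ) ^ (β + 5 / 2)) ∧
          (0 < M * N → AsympEq (fun n => (q n).eval 1)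
            (fun n => -C₃ * (n : ℝ) ^ (-α - 3 / 2))) ∧
          (M = 0 → AsympEq (fun n => (q n).eval 1)
            (fun n => -C₃ * (n : ℝ) ^ (α + 1 / 2))) ∧
          AsympEq (fun n => (derivative (q n)).eval 1)
            (fun n => C₄ * (n : ℝ) ^ (-α - 7 / 2)) := by
  have hα2 : 0 < 2 * (α + 1) := by linarith
  have hβ2 : 0 < 2 * (β + 1) := by linarith
  have hA := jacobiConst_pos hα β
  have hF := jacobiConst_pos hβ α
  obtain ⟨c, d, hc, hd, hcd⟩ := exists_sobolev_powAsymp hα hM hN hA (div_pos hA hα2)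
  refine ⟨jacobiConst β α, jacobiConst β α / (2 * (β + 1)), c, d, hF, div_pos hF hβ2, hc, hd,
    fun p q hp hq => ?_⟩
  have ha := hp.powAsymp_eval_one hα hβ
  have hb := hp.powAsymp_eval_derivative_one hα hβ
  have hf := hp.reflect.powAsymp_eval_one hβ hα
  have hg := hp.reflect.powAsymp_eval_derivative_one hβ hα
  obtain ⟨hdet, hx, hx0, hy⟩ := hcd _ _ ha hb
  choose γ hγ0 hγ1 hL using hp.sobolev_expansion hα hβ hq
  have hsol : ∀ᶠ n in atTop,
      (q n).eval 1 = γ n * sobolevValue M N (fun n => (p n).eval 1)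
        (fun n => (derivative (p n)).eval 1) n ∧
      (derivative (q n)).eval 1 = γ n * sobolevDeriv M N (fun n => (p n).eval 1)
        (fun n => (derivative (p n)).eval 1) n := hdet.mono fun n hn => sobolev_solution hn
    (hL n (leval 1)) (hL n (leval 1 ∘ₗ derivative))
  set a : ℕ → ℝ := fun n => (p n).eval 1
  set b : ℕ → ℝ := fun n => (derivative (p n)).eval 1
  set x := sobolevValue M N a b
  set y := sobolevDeriv M N a b
  -- If M = 0, then `x` has the larger order α + 1/2, but only the product M x enters and it
  -- vanishes. The factor n^(-2α-2) merely adjusts the exponent.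
  obtain ⟨m, hMx⟩ : ∃ m, PowAsymp (fun n => M * x n) (-α - 3 / 2) m := by
    rcases hM.eq_or_lt with hM0 | hM0
    · refine ⟨0, ((hx0 hM0.symm).const_mul 0 |>.mul (PowAsymp.rpow (-2 * α - 2))
        |>.cast (by ring) (by ring)).congr' (.of_forall fun n => ?_)⟩
      simp [← hM0]
    · exact ⟨_, (hx hM0).const_mul M⟩
  have hγ : Tendsto γ atTop (𝓝 1) := by
    -- Both M x a and N y b have exponent -1, so the normalization reads γ² (1 + o(1)) = 1.
    have h1 := ((hMx.mul ha).add (((hy.mul hb).const_mul N).cast (by ring) rfl)).of_lt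
      (t := 0) (by linarith)
    refine tendsto_one_of_sq_mul_tendsto_one hγ0
      (((PowAsymp.const 1).add h1).cast rfl (add_zero 1)).tendsto (hsol.mono fun n hn => ?_)
    have h2 := hγ1 n
    rw [hn.1, hn.2] at h2
    linear_combination h2
  have hs : ∀ n : ℕ, (-1 : ℝ) ^ n * (-1) ^ n = 1 := fun n => by rw [← mul_pow]; simp
  have hz : ∀ n, (p n).eval (-1) = (-1) ^ n * (C ((-1) ^ n) * (p n).comp (-X)).eval 1 := fun n => by
    rw [eval_mul, eval_C, eval_comp, eval_neg, eval_X, ← mul_assoc, hs, one_mul]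
  -- The chain rule for x ↦ -x contributes one more sign, whence the shift j = 1 for derivatives.
  have hz' : ∀ n, (derivative (p n)).eval (-1) =
      (-1) ^ (n + 1) * (derivative (C ((-1) ^ n) * (p n).comp (-X))).eval 1 := fun n => by
    rw [derivative_C_mul, derivative_comp, eval_mul, eval_mul, eval_C, eval_comp, derivative_neg,
      derivative_X, eval_neg, eval_neg, eval_one, eval_X]
    linear_combination -(derivative (p n)).eval (-1) * hs n
  have hγ' := PowAsymp.of_tendsto hγ
  have hqx := hsol.mono fun n hn => hn.1.symm
  have hqy := hsol.mono fun n hn => hn.2.symm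
  refine ⟨?_, ?_, ?_, ?_, fun hMN => ?_, fun hM0 => ?_, ?_⟩
  · refine asympEq_of_alternating (N := N) (by linarith) hF ha hb hf hMx hy hγ 0 hz
      (hsol.mono fun n hn => ?_)
    rw [← hn.1, ← hn.2]
    exact hL n (leval (-1))
  · exact hf.asympEq_mul_neg_one_pow hF.ne' 0 hz
  · refine asympEq_of_alternating (N := N) (by linarith) (div_pos hF hβ2) ha hb hg hMx hy hγ 1 hz'
      (hsol.mono fun n hn => ?_)
    rw [← hn.1, ← hn.2]
    exact hL n (leval (-1) ∘ₗ derivative)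
  · exact hg.asympEq_mul_neg_one_pow (div_pos hF hβ2).ne' 1 hz'
  · exact (((hγ'.mul (hx (pos_of_mul_pos_left hMN hN.le))).cast (zero_add _)
      (one_mul _)).congr' hqx).asympEq (neg_ne_zero.2 hc.ne')
  · exact (((hγ'.mul (hx0 hM0)).cast (zero_add _) (one_mul _)).congr' hqx).asympEq
      (neg_ne_zero.2 hc.ne')
  · exact (((hγ'.mul hy).cast (zero_add _) (one_mul _)).congr' hqy).asympEq hd.ne'
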